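/- Let $n\ge 2$ and let $\mathbb R^n$ carry the Euclidean norm. Let $G\subset\mathbb R^n$ be an unbounded open convex set which does not contain a translation $a+C$ of a convex cone $C$ with nonempty interior (a cone is a set closed under multiplication by positive scalars). A modulus is a non-decreasing function $\omega:[0,\infty)\to[0,\infty)$ with $\lim_{t\to0+}\omega(t)=0$. For an open subset $U$ of a normed space and a modulus $\omega$, write $g\in C^{1,\omega}_*(U)$ if $g:U\to\mathbb R$ is Fréchet differentiable and $\|g'(x)-g'(y)\|\le\omega(\|x-y\|)$ for all $x,y\in U$; put $C^{1,\omega}(U)=\bigcup_{K>0}C^{1,K\omega}_*(U)$. Then there exist a concave modulus $\omega$ with $\lim_{t\to\infty}\omega(t)=\infty$ and a continuous function $f:G\to\mathbb R$ such that (i) $f$ is $C^{1,\omega}_*$-smooth on all lines, i.e. for all $a\in G$ and $v\in\mathbb R^n$ with $\|v\|=1$, the function $t\mapsto f(a+tv)$ belongs to $C^{1,\omega}_*(\{t\in\mathbb R:\ a+tv\in G\})$; (ii) $f$ is $UT^1$-smooth with modulus $\omega$, i.e. for each $x\in G$ there are $b\in\mathbb R$ and a linear functional $x^*$ on $\mathbb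 R^n$ with $|f(x+h)-(b+x^*(h))|\le\|h\|\,\omega(\|h\|)$ whenever $x+h\in G$; (iii) $f\notin C^{1,\omega}(G)$. -/

import Mathlib

open Set Filter Topology

/-- The class of moduli: functions `ω : [0,∞) → [0,∞)` that are non-decreasing and satisfy
`ω(t) → 0` as `t → 0+`. Such a function is represented by a function `ℝ → ℝ` of which only the
restriction to `[0,∞)` matters. -/
structure IsModulus (ω : ℝ → ℝ) : Prop where
  nonneg : ∀ t, 0 ≤ t → 0 ≤ ω t
  mono : MonotoneOn ω (Ici 0)
  tendsto_zero : Tendsto ω (𝓝[>] 0) (𝓝 0)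

section

variable {X : Type*} [NormedAddCommGroup X] [NormedSpace ℝ X]

/-- `f ∈ C^{1,ω}_*(G)` for an open set `G`: `f` is Fréchet differentiable on `G`, and its
derivative `f'` is uniformly continuous on `G` with modulus `ω`. -/
def C1OmegaStar (ω : ℝ → ℝ) (G : Set X) (f : X → ℝ) : Prop :=
  (∀ x ∈ G, DifferentiableAt ℝ f x) ∧
    ∀ x ∈ G, ∀ y ∈ G, ‖fderiv ℝ f x - fderiv ℝ f y‖ ≤ ω ‖x - y‖

/-- `f ∈ C^{1,ω}(G)`: `f ∈ C^{1,Kω}_*(G)` for some `K > 0`. -/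
def C1Omega (ω : ℝ → ℝ) (G : Set X) (f : X → ℝ) : Prop :=
  ∃ K : ℝ, 0 < K ∧ C1OmegaStar (fun t => K * ω t) G f

/-- `f` is `C^{1,ω}_*`-smooth on all lines: for every `a ∈ G` and every unit vector `v`, the
function `t ↦ f (a + t v)` is in `C^{1,ω}_*` on `{t : a + t v ∈ G}`. -/
def C1OmegaStarOnLines (ω : ℝ → ℝ) (G : Set X) (f : X → ℝ) : Prop :=
  ∀ a ∈ G, ∀ v : X, ‖v‖ = 1 →
    C1OmegaStar ω {t : ℝ | a + t • v ∈ G} (fun t : ℝ => f (a + t • v))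

/-- `f` is `UT¹`-smooth on `G` with modulus `ω`. -/
def UT1Smooth (ω : ℝ → ℝ) (G : Set X) (f : X → ℝ) : Prop :=
  ∀ x ∈ G, ∃ (b : ℝ) (l : X →L[ℝ] ℝ), ∀ h : X, x + h ∈ G →
    |f (x + h) - (b + l h)| ≤ ‖h‖ * ω ‖h‖

/-- `G` contains a translation of a convex cone with nonempty interior. A convex cone is a convex
set closed under multiplication by positive scalars; it need not contain the origin. -/
def ContainsTranslatedSolidCone (G : Set X) : Prop :=
  ∃ (C : ConvexCone ℝ X) (a : X), (interior (C : Set X)).Nonempty ∧ ∀ x ∈ C, a + x ∈ G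

end

/-! The function is `f x = ⟪u, x⟫ * S (bracket x)`, where `S = slowSum R` tends to infinity very
slowly and `u` is a unit vector orthogonal to all recession directions of `G`. Such a `u` exists
because the recession cone cannot be solid, and compactness of the unit ball then gives `|⟪u, x⟫| ≤
ε (r + ‖x‖)` on `G` for each `ε > 0` and all large `r`. Taking `ε = 2⁻ᵏ` dictates how fast `R k`
must grow.

The gradient of `f` in the direction `u` is at least `S (bracket x)`, hence unbounded on `G`. Along
a line with unit direction `v`, however, the derivative oscillates by at most a constant: a segment
of length `|t|` inside `G` satisfies `|t ⟪u, v⟫| ≤ |⟪u, x⟫| + |⟪u, y⟫|`, which is small enough to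
absorb the variation of `S` (`abs_slowTiltDeriv_sub_le`). So every modulus dominating a multiple of
`min t 1` works on lines. Choosing a multiple of `√S` keeps it concave and unbounded, yet too small
for the gradient, which grows at least like `S` (`not_c1Omega_slowTilt`). The `UT¹` property follows
from smoothness on lines by the mean value theorem. -/

/-- The concave function `r ↦ ∑ r / (R k + r)`, which tends to infinity at infinity and grows
slowly when the sequence `R` grows fast. -/
noncomputable def slowSum (R : ℕ → ℝ) (r : ℝ) : ℝ := ∑' k, r / (R k + r)

/-- The derivative of `slowSum R`. -/
noncomputable def slowSumDeriv (R : ℕ → ℝ) (r : ℝ) : ℝ := ∑' k, R k / (R k + r) ^ 2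

/-! ### Weighted estimates for the slow sum and its derivative. -/

section SlowSum

lemma abs_tsum_sub_tsum_mul_le {p q : ℕ → ℝ} (hp : Summable p) (hq : Summable q) {m B : ℝ}
    (hm : 0 ≤ m) (h : ∀ k, |p k - q k| * m ≤ (1 / 2) ^ k * B) :
    |∑' k, p k - ∑' k, q k| * m ≤ 2 * B := by
  have hB : HasSum (fun k : ℕ => (1 / 2 : ℝ) ^ k * B) (2 * B) := hasSum_geometric_two.mul_right B
  rw [← hp.tsum_sub hq, ← abs_of_nonneg hm, ← abs_mul, ← tsum_mul_right, ← Real.norm_eq_abs]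
  refine tsum_of_norm_bounded hB fun k => ?_
  rw [Real.norm_eq_abs, abs_mul, abs_of_nonneg hm]
  exact h k

variable {R : ℕ → ℝ}

lemma one_le_half_pow_mul (hR : ∀ k, 2 ^ k ≤ R k) {a : ℝ} (ha : 0 ≤ a) (k : ℕ) :
    1 ≤ (1 / 2 : ℝ) ^ k * (R k + a) := by
  have h : (1 / 2 : ℝ) ^ k * 2 ^ k = 1 := by rw [← mul_pow]; norm_num
  calc (1 : ℝ) = (1 / 2 : ℝ) ^ k * 2 ^ k := h.symm
    _ ≤ _ := by have := hR k; gcongr; linarith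

lemma pos_of_two_pow_le (hR : ∀ k, 2 ^ k ≤ R k) (k : ℕ) : 0 < R k :=
  (by positivity : (0 : ℝ) < 2 ^ k).trans_le (hR k)

lemma inv_le_half_pow (hR : ∀ k, 2 ^ k ≤ R k) {a : ℝ} (ha : 0 ≤ a) (k : ℕ) :
    1 / (R k + a) ≤ (1 / 2 : ℝ) ^ k := by
  have := pos_of_two_pow_le hR k
  rw [div_le_iff₀ (by positivity)]
  exact one_le_half_pow_mul hR ha k

lemma summable_slowSum (hR : ∀ k, 2 ^ k ≤ R k) {a : ℝ} (ha : 0 ≤ a) :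
    Summable fun k => a / (R k + a) := by
  refine Summable.of_nonneg_of_le (fun k => ?_) (fun k => ?_) (summable_geometric_two.mul_left a)
  · have := pos_of_two_pow_le hR k
    positivity
  · rw [div_eq_mul_one_div]
    exact mul_le_mul_of_nonneg_left (inv_le_half_pow hR ha k) ha

lemma div_sq_le_half_pow (hR : ∀ k, 2 ^ k ≤ R k) {a : ℝ} (ha : 0 ≤ a) (k : ℕ) :
    R k / (R k + a) ^ 2 ≤ (1 / 2 : ℝ) ^ k := by
  have := pos_of_two_pow_le hR k
  refine le_trans ?_ (inv_le_half_pow hR ha k)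
  rw [div_le_div_iff₀ (by positivity) (by positivity)]
  nlinarith

lemma summable_slowSumDeriv (hR : ∀ k, 2 ^ k ≤ R k) {a : ℝ} (ha : 0 ≤ a) :
    Summable fun k => R k / (R k + a) ^ 2 := by
  refine Summable.of_nonneg_of_le (fun k => ?_) (div_sq_le_half_pow hR ha) summable_geometric_two
  have := pos_of_two_pow_le hR k
  positivity

lemma slowSumDeriv_nonneg (hR : ∀ k, 2 ^ k ≤ R k) {a : ℝ} (ha : 0 ≤ a) :
    0 ≤ slowSumDeriv R a := by
  refine tsum_nonneg fun k => ?_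
  have := pos_of_two_pow_le hR k
  positivity

lemma slowSum_zero : slowSum R 0 = 0 := by simp [slowSum]

lemma hasDerivAt_slowSum (hR : ∀ k, 2 ^ k ≤ R k) {a : ℝ} (ha : 0 < a) :
    HasDerivAt (slowSum R) (slowSumDeriv R a) a := by
  refine hasDerivAt_tsum_of_isPreconnected (t := Ioi 0) (g := fun k y => y / (R k + y))
    (g' := fun k y => R k / (R k + y) ^ 2) summable_geometric_two isOpen_Ioi isPreconnected_Ioi
    (fun k y hy => ?_) (fun k y hy => ?_) (mem_Ioi.2 ha) (summable_slowSum hR ha.le) (mem_Ioi.2 ha)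
  · have := pos_of_two_pow_le hR k
    have hy' : 0 < y := hy
    have h := (hasDerivAt_id' y).fun_div ((hasDerivAt_id' y).const_add (R k)) (by positivity)
    exact h.congr_deriv (by ring)
  · have := pos_of_two_pow_le hR k
    have hy' : 0 < y := hy
    rw [Real.norm_of_nonneg (by positivity)]
    exact div_sq_le_half_pow hR hy'.le k

/-- The `k`-th terms differ by at most `|b - a| / (R k + a)`, so the weight `m` cancels the
denominator and leaves a geometric series. The weight is later `|⟪u, x⟫|` with `a = bracket x`; `m =
1` gives the plain Lipschitz bound. -/
lemma abs_slowSum_sub_mul_le (hR : ∀ k, 2 ^ k ≤ R k) {a b m : ℝ} (ha : 0 ≤ a) (hb : 0 ≤ b)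
    (hm : 0 ≤ m) (h : ∀ k, m ≤ (1 / 2) ^ k * (R k + a)) :
    |slowSum R b - slowSum R a| * m ≤ 2 * |b - a| := by
  refine abs_tsum_sub_tsum_mul_le (summable_slowSum hR hb) (summable_slowSum hR ha) hm fun k => ?_
  have hk := pos_of_two_pow_le hR k
  have e : b / (R k + b) - a / (R k + a) = R k / (R k + b) / (R k + a) * (b - a) := by
    field_simp
    ring
  rw [e, abs_mul, abs_of_nonneg (by positivity)]
  calc R k / (R k + b) / (R k + a) * |b - a| * m
      ≤ 1 / (R k + a) * |b - a| * ((1 / 2) ^ k * (R k + a)) := by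
        gcongr
        · exact div_le_one_of_le₀ (by linarith) (by positivity)
        · exact h k
    _ = (1 / 2) ^ k * |b - a| := by field_simp

lemma slowSumDeriv_mul_le (hR : ∀ k, 2 ^ k ≤ R k) {a m : ℝ} (ha : 0 ≤ a)
    (hm : 0 ≤ m) (h : ∀ k, m ≤ (1 / 2) ^ k * (R k + a)) :
    slowSumDeriv R a * m ≤ 2 := by
  have key := abs_tsum_sub_tsum_mul_le (summable_slowSumDeriv hR ha) (summable_zero (β := ℕ)) hm
    (B := 1) fun k => ?_
  · simpa [slowSumDeriv, abs_of_nonneg (slowSumDeriv_nonneg hR ha)] using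
      (mul_le_mul_of_nonneg_right (le_abs_self _) hm).trans key
  have hk := pos_of_two_pow_le hR k
  rw [sub_zero, abs_of_nonneg (by positivity)]
  calc R k / (R k + a) ^ 2 * m ≤ (R k + a) / (R k + a) ^ 2 * ((1 / 2) ^ k * (R k + a)) := by
        gcongr
        · linarith
        · exact h k
    _ = (1 / 2) ^ k * 1 := by field_simp

lemma abs_slowSumDeriv_sub_mul_le (hR : ∀ k, 2 ^ k ≤ R k) {a b m : ℝ} (ha : 0 ≤ a) (hb : 0 ≤ b)
    (hm : 0 ≤ m) (h : ∀ k, m ≤ (1 / 2) ^ k * (R k + a)) :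
    |slowSumDeriv R b - slowSumDeriv R a| * m ≤ 4 * |b - a| := by
  have key := abs_tsum_sub_tsum_mul_le (summable_slowSumDeriv hR hb) (summable_slowSumDeriv hR ha)
    hm (B := 2 * |b - a|) fun k => ?_
  · exact key.trans_eq (by ring)
  have hk := pos_of_two_pow_le hR k
  have hk1 : 1 ≤ R k := (one_le_pow₀ one_le_two).trans (hR k)
  have e : R k / (R k + b) ^ 2 - R k / (R k + a) ^ 2 =
      -((R k / (R k + b) / (R k + b) + R k / (R k + b) / (R k + a)) / (R k + a) * (b - a)) := by
    field_simp
    ring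
  have h1 : R k / (R k + b) / (R k + b) ≤ 1 := by
    rw [div_div]
    exact div_le_one_of_le₀ (by nlinarith) (by positivity)
  have h2 : R k / (R k + b) / (R k + a) ≤ 1 := by
    rw [div_div]
    exact div_le_one_of_le₀ (by nlinarith [mul_nonneg ha hb]) (by positivity)
  rw [e, abs_neg, abs_mul, abs_of_nonneg (by positivity)]
  calc (R k / (R k + b) / (R k + b) + R k / (R k + b) / (R k + a)) / (R k + a) * |b - a| * m
      ≤ (1 + 1) / (R k + a) * |b - a| * ((1 / 2) ^ k * (R k + a)) := by
        gcongr
        exact h k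
    _ = (1 / 2) ^ k * (2 * |b - a|) := by field_simp; ring

lemma abs_slowSum_sub_le (hR : ∀ k, 2 ^ k ≤ R k) {a b : ℝ} (ha : 0 ≤ a) (hb : 0 ≤ b) :
    |slowSum R b - slowSum R a| ≤ 2 * |b - a| := by
  simpa using abs_slowSum_sub_mul_le hR ha hb zero_le_one (one_le_half_pow_mul hR ha)

lemma slowSum_nonneg (hR : ∀ k, 2 ^ k ≤ R k) {a : ℝ} (ha : 0 ≤ a) : 0 ≤ slowSum R a := by
  refine tsum_nonneg fun k => ?_
  have := pos_of_two_pow_le hR k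
  positivity

lemma monotoneOn_slowSum (hR : ∀ k, 2 ^ k ≤ R k) : MonotoneOn (slowSum R) (Ici 0) := by
  intro a ha b hb hab
  have ha' : 0 ≤ a := ha
  have hb' : 0 ≤ b := hb
  refine (summable_slowSum hR ha').tsum_le_tsum (fun k => ?_) (summable_slowSum hR hb')
  have hk := pos_of_two_pow_le hR k
  rw [div_le_div_iff₀ (by positivity) (by positivity)]
  nlinarith

lemma concaveOn_slowSum (hR : ∀ k, 2 ^ k ≤ R k) : ConcaveOn ℝ (Ici 0) (slowSum R) := by
  refine ⟨convex_Ici 0, fun x hx y hy s t hs ht hst => ?_⟩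
  have hx' : 0 ≤ x := hx
  have hy' : 0 ≤ y := hy
  have hz : 0 ≤ s * x + t * y := by positivity
  simp only [slowSum, smul_eq_mul, ← tsum_mul_left]
  rw [← ((summable_slowSum hR hx').mul_left s).tsum_add ((summable_slowSum hR hy').mul_left t)]
  refine Summable.tsum_le_tsum (fun k => ?_)
    (((summable_slowSum hR hx').mul_left s).add ((summable_slowSum hR hy').mul_left t))
    (summable_slowSum hR hz)
  have hk := pos_of_two_pow_le hR k
  set z := s * x + t * y with hzdef
  -- Each term lies below its tangent line at `z`; averaging cancels the linear parts.
  have key : ∀ p, 0 ≤ p → p / (R k + p) ≤ z / (R k + z) + R k / (R k + z) ^ 2 * (p - z) := by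
    intro p hp
    have e : z / (R k + z) + R k / (R k + z) ^ 2 * (p - z) - p / (R k + p) =
        R k * (p - z) ^ 2 / ((R k + p) * (R k + z) ^ 2) := by
      field_simp
      ring
    have : 0 ≤ R k * (p - z) ^ 2 / ((R k + p) * (R k + z) ^ 2) := by positivity
    linarith
  calc s * (x / (R k + x)) + t * (y / (R k + y))
      ≤ s * (z / (R k + z) + R k / (R k + z) ^ 2 * (x - z)) +
        t * (z / (R k + z) + R k / (R k + z) ^ 2 * (y - z)) := by
        gcongr
        · exact key x hx'
        · exact key y hy'
    _ = (s + t) * (z / (R k + z)) + R k / (R k + z) ^ 2 * (s * x + t * y - (s + t) * z) := by ring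
    _ = z / (R k + z) := by rw [hst, ← hzdef]; ring

/-- Each term tends to `1`, so the first `N` terms alone eventually exceed any bound below `N`. -/
lemma tendsto_slowSum (hR : ∀ k, 2 ^ k ≤ R k) : Tendsto (slowSum R) atTop atTop := by
  refine tendsto_atTop.2 fun B => ?_
  obtain ⟨N, hN⟩ := exists_nat_gt B
  have hlim : Tendsto (fun r => ∑ k ∈ Finset.range N, r / (R k + r)) atTop
      (𝓝 (∑ _k ∈ Finset.range N, (1 : ℝ))) := by
    refine tendsto_finsetSum _ fun k _ => ?_
    have hk := pos_of_two_pow_le hR k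
    have h0 : Tendsto (fun r => 1 - R k / (R k + r)) atTop (𝓝 (1 - 0)) :=
      tendsto_const_nhds.sub
        (tendsto_const_nhds.div_atTop (tendsto_atTop_add_const_left _ _ tendsto_id))
    rw [sub_zero] at h0
    refine h0.congr' ?_
    filter_upwards [eventually_ge_atTop 0] with r hr
    field_simp
    ring
  rw [Finset.sum_const, Finset.card_range, nsmul_one] at hlim
  filter_upwards [hlim.eventually_const_lt hN, eventually_ge_atTop 0] with r hr hr0
  refine hr.le.trans ((summable_slowSum hR hr0).sum_le_tsum _ fun k _ => ?_)
  have hk := pos_of_two_pow_le hR k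
  positivity

lemma div_le_slowSum (hR : ∀ k, 2 ^ k ≤ R k) {a : ℝ} (ha : 0 ≤ a) :
    a / (R 0 + a) ≤ slowSum R a := by
  refine (summable_slowSum hR ha).le_tsum 0 fun k _ => ?_
  have hk := pos_of_two_pow_le hR k
  positivity

/-- The square root of `slowSum R` dominates `min t 1` up to a factor. -/
lemma min_le_mul_sqrt_slowSum (hR : ∀ k, 2 ^ k ≤ R k) {t : ℝ} (ht : 0 ≤ t) :
    min t 1 ≤ (R 0 + 1) * √(slowSum R t) := by
  have h0 := pos_of_two_pow_le hR 0
  have hm : 0 ≤ min t 1 := le_min ht zero_le_one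
  have h1 : min t 1 / (R 0 + 1) ≤ slowSum R t := by
    calc min t 1 / (R 0 + 1) ≤ min t 1 / (R 0 + min t 1) := by
          gcongr
          exact min_le_right _ _
      _ ≤ slowSum R (min t 1) := div_le_slowSum hR hm
      _ ≤ slowSum R t := monotoneOn_slowSum hR hm ht (min_le_left _ _)
  -- The left side lies in `[0, 1]`, so its square is at most itself.
  have h2 : min t 1 / (R 0 + 1) ≤ √(slowSum R t) := by
    refine Real.le_sqrt_of_sq_le (le_trans ?_ h1)
    have : min t 1 / (R 0 + 1) ≤ 1 :=
      div_le_one_of_le₀ ((min_le_right _ _).trans (by linarith)) (by positivity)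
    have : 0 ≤ min t 1 / (R 0 + 1) := by positivity
    nlinarith
  rw [div_le_iff₀ (by positivity)] at h2
  linarith

end SlowSum

/-! ### The modulus as a multiple of the square root of the slow sum. -/

/-- A modulus of the form `M * √(slowSum R t)`. -/
lemma isModulus_mul_sqrt_slowSum {R : ℕ → ℝ} (hR : ∀ k, 2 ^ k ≤ R k) {M : ℝ} (hM : 0 ≤ M) :
    IsModulus fun t => M * √(slowSum R t) := by
  refine ⟨fun t _ => by positivity, fun a ha b hb hab => ?_, ?_⟩
  · exact mul_le_mul_of_nonneg_left (Real.sqrt_le_sqrt (monotoneOn_slowSum hR ha hb hab)) hM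
  · have h : Tendsto (slowSum R) (𝓝[>] 0) (𝓝 0) := by
      have h2 : Tendsto (fun t : ℝ => 2 * t) (𝓝[>] 0) (𝓝 0) :=
        ((continuous_const_mul (2 : ℝ)).tendsto' 0 0 (by simp)).mono_left nhdsWithin_le_nhds
      refine squeeze_zero' ?_ ?_ h2
      · filter_upwards [self_mem_nhdsWithin] with t ht using slowSum_nonneg hR (le_of_lt ht)
      · filter_upwards [self_mem_nhdsWithin] with t ht
        have ht' : 0 < t := ht
        have := abs_slowSum_sub_le hR le_rfl ht'.le
        rw [slowSum_zero, sub_zero, sub_zero, abs_of_pos ht'] at this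
        exact (le_abs_self _).trans this
    simpa using h.sqrt.const_mul M

lemma concaveOn_mul_sqrt_slowSum {R : ℕ → ℝ} (hR : ∀ k, 2 ^ k ≤ R k) {M : ℝ} (hM : 0 ≤ M) :
    ConcaveOn ℝ (Ici 0) fun t => M * √(slowSum R t) := by
  refine ConcaveOn.smul hM ⟨convex_Ici 0, fun x hx y hy s t hs ht hst => ?_⟩
  have h1 := Real.strictConcaveOn_sqrt.concaveOn.2 (slowSum_nonneg hR hx) (slowSum_nonneg hR hy)
    hs ht hst
  exact h1.trans (Real.sqrt_le_sqrt ((concaveOn_slowSum hR).2 hx hy hs ht hst))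

lemma tendsto_mul_sqrt_slowSum {R : ℕ → ℝ} (hR : ∀ k, 2 ^ k ≤ R k) {M : ℝ} (hM : 0 < M) :
    Tendsto (fun t => M * √(slowSum R t)) atTop atTop :=
  (Real.tendsto_sqrt_atTop.comp (tendsto_slowSum hR)).const_mul_atTop hM

/-! ### Recession cones and sublinear growth. -/

section Recession

variable {E : Type*} [NormedAddCommGroup E] [InnerProductSpace ℝ E]

/-- The recession cone of a set. -/
def recessionCone (G : Set E) : ConvexCone ℝ E where
  carrier := {v | ∀ x ∈ G, ∀ s : ℝ, 0 < s → x + s • v ∈ G}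
  smul_mem' c hc v hv x hx s hs := by
    rw [smul_smul]
    exact hv x hx _ (mul_pos hs hc)
  add_mem' v hv w hw x hx s hs := by
    rw [smul_add, ← add_assoc]
    exact hw _ (hv x hx s hs) s hs

/-- Limits of directions of sequences escaping to infinity in an open convex set are recession
directions. -/
lemma mem_recessionCone_of_tendsto {G : Set E} (hG : IsOpen G) (hc : Convex ℝ G) {x : ℕ → E}
    (hx : ∀ k, x k ∈ G) (hx' : Tendsto (fun k => ‖x k‖) atTop atTop) {y : E}
    (hy : Tendsto (fun k => ‖x k‖⁻¹ • x k) atTop (𝓝 y)) : y ∈ recessionCone G := by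
  intro p hp s hs
  -- The limit only gives membership in the closure. Going twice as far makes `p + s • y` the
  -- midpoint of this point and the interior point `p`, hence a point of `G`.
  have hcl : p + (2 * s) • y ∈ closure G := by
    have hinv : Tendsto (fun k => 2 * s * ‖x k‖⁻¹) atTop (𝓝 0) := by
      simpa using (tendsto_inv_atTop_zero.comp hx').const_mul (2 * s)
    have hlim : Tendsto (fun k => (1 - 2 * s * ‖x k‖⁻¹) • p + (2 * s * ‖x k‖⁻¹) • x k) atTop
        (𝓝 ((1 - (0 : ℝ)) • p + (2 * s) • y)) := by
      refine ((tendsto_const_nhds.sub hinv).smul_const p).add ?_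
      simpa only [smul_smul] using hy.const_smul (2 * s)
    rw [sub_zero, one_smul] at hlim
    refine mem_closure_of_tendsto hlim ?_
    filter_upwards [hinv.eventually_le_const one_pos] with k hk
    exact hc hp (hx k) (by linarith) (by positivity) (by ring)
  have := hc.combo_interior_closure_mem_interior (hG.interior_eq.symm ▸ hp) hcl
    (a := 1 / 2) (b := 1 / 2) (by norm_num) (by norm_num) (by norm_num)
  rw [hG.interior_eq] at this
  convert this using 1
  module

variable [FiniteDimensional ℝ E]

/-- A translate of the recession cone lies in `G`, so the cone has empty interior. Being convex and
containing `0`, it then spans a proper subspace, whose orthogonal complement supplies `u`. -/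
lemma exists_unit_orthogonal_recessionCone {G : Set E} (hne : G.Nonempty)
    (hG : ¬ ContainsTranslatedSolidCone G) :
    ∃ u : E, ‖u‖ = 1 ∧ ∀ v ∈ recessionCone G, inner ℝ u v = 0 := by
  obtain ⟨a, ha⟩ := hne
  have hint : ¬ (interior (recessionCone G : Set E)).Nonempty := fun h =>
    hG ⟨recessionCone G, a, h, fun v hv => by simpa using hv a ha 1 one_pos⟩
  rw [(recessionCone G).convex.interior_nonempty_iff_affineSpan_eq_top] at hint
  have hspan : Submodule.span ℝ (recessionCone G : Set E) ≠ ⊤ := by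
    intro h
    have h0 : (0 : E) ∈ (recessionCone G : Set E) := fun x hx s _ => by simpa using hx
    have h1 := affineSpan_insert_zero (k := ℝ) (recessionCone G : Set E)
    rw [insert_eq_self.2 h0, h] at h1
    exact hint (SetLike.coe_injective (by rw [h1]; rfl))
  have hort : (Submodule.span ℝ (recessionCone G : Set E))ᗮ ≠ ⊥ :=
    fun h => hspan (Submodule.orthogonal_eq_bot_iff.1 h)
  obtain ⟨w, hw, hw0⟩ := Submodule.exists_mem_ne_zero_of_ne_bot hort
  refine ⟨‖w‖⁻¹ • w, norm_smul_inv_norm hw0, fun v hv => ?_⟩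
  rw [real_inner_smul_left, Submodule.inner_left_of_mem_orthogonal (Submodule.subset_span hv) hw,
    mul_zero]

/-- In a direction orthogonal to the recession cone, an open convex set grows sublinearly. -/
lemma exists_forall_abs_inner_le {G : Set E} (hG : IsOpen G) (hc : Convex ℝ G) {u : E}
    (hu1 : ‖u‖ = 1) (hu : ∀ v ∈ recessionCone G, inner ℝ u v = 0) {ε : ℝ} (hε : 0 < ε) :
    ∃ B : ℝ, ∀ r, B ≤ r → ∀ x ∈ G, |inner ℝ u x| ≤ ε * (r + ‖x‖) := by
  suffices h : ∃ k : ℕ, ∀ x ∈ G, |inner ℝ u x| ≤ ε * (k + ‖x‖) by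
    obtain ⟨k, hk⟩ := h
    refine ⟨k, fun r hr x hx => (hk x hx).trans ?_⟩
    gcongr
  -- Counterexamples `x k` satisfy `ε k ≤ ‖x k‖`, so they escape to infinity. A limit of their
  -- directions is a recession direction `y` with `|⟪u, y⟫| ≥ ε`, contradicting orthogonality.
  by_contra! hcon
  choose x hxG hx using hcon
  have hle : ∀ k, |inner ℝ u (x k)| ≤ ‖x k‖ := fun k => by
    simpa [hu1] using abs_real_inner_le_norm u (x k)
  have hbig : ∀ k : ℕ, ε * k ≤ ‖x k‖ := fun k => by
    have := hx k
    have := hle k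
    have : 0 ≤ ε * ‖x k‖ := by positivity
    linarith
  have htend : Tendsto (fun k => ‖x k‖) atTop atTop :=
    tendsto_atTop_mono hbig (tendsto_natCast_atTop_atTop.const_mul_atTop hε)
  have hball : ∀ k, ‖x k‖⁻¹ • x k ∈ Metric.closedBall (0 : E) 1 := fun k => by
    rw [mem_closedBall_zero_iff, norm_smul, norm_inv, norm_norm]
    exact inv_mul_le_one
  obtain ⟨y, -, ψ, hψ, hy⟩ := (isCompact_closedBall (0 : E) 1).tendsto_subseq hball
  have hymem : y ∈ recessionCone G :=
    mem_recessionCone_of_tendsto hG hc (fun k => hxG (ψ k)) (htend.comp hψ.tendsto_atTop) hy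
  have hlim : Tendsto (fun k => |inner ℝ u (‖x (ψ k)‖⁻¹ • x (ψ k))|) atTop
      (𝓝 |inner ℝ u y|) := (tendsto_const_nhds.inner hy).abs
  have hge : ε ≤ |inner ℝ u y| := by
    refine ge_of_tendsto hlim (Eventually.of_forall fun k => ?_)
    have h1 := hx (ψ k)
    have h0 : 0 < ‖x (ψ k)‖ := by
      have := hle (ψ k)
      have : 0 ≤ ε * ((ψ k : ℝ) + ‖x (ψ k)‖) := by positivity
      linarith
    rw [real_inner_smul_right, abs_mul, abs_inv, abs_norm, inv_mul_eq_div, le_div_iff₀ h0]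
    have : 0 ≤ ε * (ψ k : ℝ) := by positivity
    linarith
  rw [hu y hymem, abs_zero] at hge
  linarith

end Recession

/-! ### The smoothed norm and the counterexample built from it. -/

section Bracket

variable {E : Type*} [NormedAddCommGroup E]

/-- The smooth substitute `√(1 + ‖x‖²)` for the norm. -/
noncomputable def bracket (x : E) : ℝ := √(1 + ‖x‖ ^ 2)

lemma one_le_bracket (x : E) : 1 ≤ bracket x :=
  Real.one_le_sqrt.2 (by nlinarith [sq_nonneg ‖x‖])

lemma norm_le_bracket (x : E) : ‖x‖ ≤ bracket x :=
  Real.le_sqrt_of_sq_le (by linarith)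

lemma bracket_sq (x : E) : bracket x ^ 2 = 1 + ‖x‖ ^ 2 := Real.sq_sqrt (by positivity)

lemma abs_bracket_sub_le (x y : E) : |bracket y - bracket x| ≤ ‖y - x‖ := by
  have hx := one_le_bracket x
  have hy := one_le_bracket y
  -- The squares of `bracket` and of the norm differ by a constant, so both have the same
  -- differences of squares.
  have h1 : |bracket y - bracket x| * (bracket y + bracket x) = |‖y‖ - ‖x‖| * (‖y‖ + ‖x‖) := by
    rw [← abs_of_nonneg (show 0 ≤ bracket y + bracket x by linarith), ← abs_mul,
      ← abs_of_nonneg (show 0 ≤ ‖y‖ + ‖x‖ by positivity), ← abs_mul]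
    congr 1
    linear_combination bracket_sq y - bracket_sq x
  refine le_trans ?_ (abs_norm_sub_norm_le y x)
  refine le_of_mul_le_mul_right (h1.trans_le ?_) (show 0 < bracket y + bracket x by linarith)
  exact mul_le_mul_of_nonneg_left (add_le_add (norm_le_bracket y) (norm_le_bracket x))
    (abs_nonneg _)

variable [InnerProductSpace ℝ E]

lemma hasFDerivAt_bracket (x : E) :
    HasFDerivAt bracket ((bracket x)⁻¹ • innerSL ℝ x) x := by
  have h := ((hasStrictFDerivAt_norm_sq x).hasFDerivAt.const_add 1).sqrt (by positivity)
  refine h.congr_fderiv ?_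
  ext v
  simp only [bracket, smul_apply, smul_eq_mul, nsmul_eq_mul, Nat.cast_ofNat]
  field_simp

lemma abs_inner_div_bracket_le {x v : E} (hv : ‖v‖ = 1) : |inner ℝ x v / bracket x| ≤ 1 := by
  have hx := one_le_bracket x
  rw [abs_div, abs_of_nonneg (show 0 ≤ bracket x by linarith)]
  refine div_le_one_of_le₀ ?_ (by linarith)
  have := abs_real_inner_le_norm x v
  rw [hv, mul_one] at this
  exact this.trans (norm_le_bracket x)

lemma abs_inner_div_bracket_sub_le {x v : E} (hv : ‖v‖ = 1) (t : ℝ) :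
    |inner ℝ (x + t • v) v / bracket (x + t • v) - inner ℝ x v / bracket x| ≤ 2 * |t| := by
  set y := x + t • v with hy
  have hx := one_le_bracket x
  have hy1 := one_le_bracket y
  have hbr := abs_bracket_sub_le x y
  have hyx : ‖y - x‖ = |t| := by simp [hy, norm_smul, hv]
  rw [hyx] at hbr
  have hin : inner ℝ y v = inner ℝ x v + t := by
    rw [hy, inner_add_left, real_inner_smul_left, real_inner_self_eq_norm_sq, hv]
    ring
  have e : inner ℝ y v / bracket y - inner ℝ x v / bracket x =
      (t - inner ℝ x v / bracket x * (bracket y - bracket x)) / bracket y := by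
    rw [hin]
    field_simp
    ring
  have hq := abs_inner_div_bracket_le (x := x) hv
  rw [e, abs_div, abs_of_nonneg (show 0 ≤ bracket y by linarith)]
  refine (div_le_self (abs_nonneg _) hy1).trans ((abs_sub _ _).trans ?_)
  rw [abs_mul]
  nlinarith [abs_nonneg (bracket y - bracket x), abs_nonneg t]

/-- The product of the linear functional `⟪u, ·⟫` with a slowly growing radial function. -/
noncomputable def slowTilt (R : ℕ → ℝ) (u x : E) : ℝ := inner ℝ u x * slowSum R (bracket x)

/-- The directional derivative of `slowTilt R u`. -/
noncomputable def slowTiltDeriv (R : ℕ → ℝ) (u x v : E) : ℝ :=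
  inner ℝ u v * slowSum R (bracket x) +
    inner ℝ u x * (slowSumDeriv R (bracket x) * (inner ℝ x v / bracket x))

variable {R : ℕ → ℝ} {u : E}

lemma hasFDerivAt_slowTilt (hR : ∀ k, 2 ^ k ≤ R k) (x : E) :
    ∃ L : E →L[ℝ] ℝ, HasFDerivAt (slowTilt R u) L x ∧ ∀ v, L v = slowTiltDeriv R u x v := by
  have hx := one_le_bracket x
  have h1 : HasFDerivAt (fun x => slowSum R (bracket x)) _ x :=
    (hasDerivAt_slowSum hR (show 0 < bracket x by linarith)).comp_hasFDerivAt x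
      (hasFDerivAt_bracket x)
  have h2 : HasFDerivAt (fun x => inner ℝ u x) (innerSL ℝ u) x := (innerSL ℝ u).hasFDerivAt
  refine ⟨_, h2.mul h1, fun v => ?_⟩
  simp [slowTiltDeriv]
  ring

lemma differentiable_slowTilt (hR : ∀ k, 2 ^ k ≤ R k) : Differentiable ℝ (slowTilt R u) := fun x =>
  let ⟨_, hL, _⟩ := hasFDerivAt_slowTilt hR x
  hL.differentiableAt

lemma fderiv_slowTilt (hR : ∀ k, 2 ^ k ≤ R k) (x v : E) :
    fderiv ℝ (slowTilt R u) x v = slowTiltDeriv R u x v := by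
  obtain ⟨L, hL, h⟩ := hasFDerivAt_slowTilt (u := u) hR x
  rw [hL.fderiv, h]

variable {G : Set E}

/-- The heart of the argument: a Lipschitz bound for short segments, and a bound independent of
length although `slowSum R` is unbounded. -/
lemma abs_slowTiltDeriv_sub_le (hR : ∀ k, 2 ^ k ≤ R k) (hu : ‖u‖ = 1)
    (hG : ∀ k, ∀ x ∈ G, |inner ℝ u x| ≤ (1 / 2) ^ k * (R k + ‖x‖)) {x v : E} {t : ℝ}
    (hv : ‖v‖ = 1) (hx : x ∈ G) (hy : x + t • v ∈ G) :
    |slowTiltDeriv R u (x + t • v) v - slowTiltDeriv R u x v| ≤ 12 * min |t| 1 := by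
  set y := x + t • v with hydef
  have hyx : ‖y - x‖ = |t| := by simp [hydef, norm_smul, hv]
  have hGb : ∀ z ∈ G, ∀ k, |inner ℝ u z| ≤ (1 / 2) ^ k * (R k + bracket z) := fun z hz k =>
    (hG k z hz).trans (by gcongr; exact norm_le_bracket z)
  have hbx : 0 ≤ bracket x := zero_le_one.trans (one_le_bracket x)
  have hby : 0 ≤ bracket y := zero_le_one.trans (one_le_bracket y)
  have hbr : |bracket y - bracket x| ≤ |t| := hyx ▸ abs_bracket_sub_le x y
  have hl : inner ℝ u y - inner ℝ u x = t * inner ℝ u v := by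
    rw [hydef, inner_add_right, real_inner_smul_right]
    ring
  have hlv : |inner ℝ u v| ≤ 1 := by simpa [hu, hv] using abs_real_inner_le_norm u v
  have hdx := slowSumDeriv_nonneg hR hbx
  have hdy := slowSumDeriv_nonneg hR hby
  have hqx := abs_inner_div_bracket_le (x := x) hv
  have hqy := abs_inner_div_bracket_le (x := y) hv
  have hq : |inner ℝ y v / bracket y - inner ℝ x v / bracket x| ≤ 2 * |t| :=
    abs_inner_div_bracket_sub_le hv t
  have hSx := abs_slowSum_sub_mul_le hR hbx hby (abs_nonneg _) (hGb x hx)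
  have hSy := abs_slowSum_sub_mul_le hR hby hbx (abs_nonneg _) (hGb y hy)
  have hS := abs_slowSum_sub_le hR hbx hby
  have hDx := slowSumDeriv_mul_le hR hbx (abs_nonneg _) (hGb x hx)
  have hDy := slowSumDeriv_mul_le hR hby (abs_nonneg _) (hGb y hy)
  have hD : slowSumDeriv R (bracket y) ≤ 2 := by
    simpa using slowSumDeriv_mul_le hR hby zero_le_one (one_le_half_pow_mul hR hby)
  have hDD := abs_slowSumDeriv_sub_mul_le hR hbx hby (abs_nonneg _) (hGb x hx)
  rw [abs_sub_comm (slowSum R (bracket x)), abs_sub_comm (bracket x)] at hSy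
  simp only [slowTiltDeriv]
  generalize inner ℝ y v / bracket y = qy at *
  generalize inner ℝ x v / bracket x = qx at *
  generalize slowSumDeriv R (bracket y) = dy at *
  generalize slowSumDeriv R (bracket x) = dx at *
  generalize slowSum R (bracket y) = sy at *
  generalize slowSum R (bracket x) = sx at *
  generalize inner ℝ u y = ly at *
  generalize inner ℝ u x = lx at *
  generalize inner ℝ u v = lv at *
  rw [mul_min_of_nonneg _ _ (by norm_num : (0 : ℝ) ≤ 12), mul_one]
  refine le_min ?_ ?_
  -- Short segments: change one factor at a time. The four pieces contribute `2 + 2 + 4 + 4 = 12`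
  -- times `|t|`.
  · have e : lv * sy + ly * (dy * qy) - (lv * sx + lx * (dx * qx)) =
        lv * (sy - sx) + (t * lv * (dy * qy) + ((dy - dx) * lx * qy + dx * lx * (qy - qx))) := by
      linear_combination (dy * qy) * hl
    rw [e]
    have b1 : |lv * (sy - sx)| ≤ 2 * |t| := by
      rw [abs_mul]
      exact (mul_le_mul hlv (hS.trans (by linarith)) (abs_nonneg _) zero_le_one).trans_eq
        (one_mul _)
    have b2 : |t * lv * (dy * qy)| ≤ |t| * 1 * (2 * 1) := by
      rw [abs_mul, abs_mul, abs_mul, abs_of_nonneg hdy]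
      gcongr
    have b3 : |(dy - dx) * lx * qy| ≤ 4 * |t| * 1 := by
      rw [abs_mul, abs_mul]
      exact mul_le_mul (hDD.trans (by linarith)) hqy (abs_nonneg _) (by positivity)
    have b4 : |dx * lx * (qy - qx)| ≤ 2 * (2 * |t|) := by
      rw [abs_mul, abs_mul, abs_of_nonneg hdx]
      gcongr
    refine (abs_add_le _ _).trans ?_
    have := abs_add_le (t * lv * (dy * qy)) ((dy - dx) * lx * qy + dx * lx * (qy - qx))
    have := abs_add_le ((dy - dx) * lx * qy) (dx * lx * (qy - qx))
    linarith
  -- Long segments: after multiplication by `|t|`, the factor `t * lv` equals `ly - lx`, and the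
  -- weighted estimates based at `x` and at `y` each cost `2 * |t|`.
  · have b1 : |lv * (sy - sx)| ≤ 4 := by
      rcases eq_or_ne t 0 with rfl | ht
      · have h0 : |sy - sx| ≤ 0 := by
          rw [abs_zero] at hbr
          linarith
        rw [abs_mul, le_antisymm h0 (abs_nonneg _)]
        norm_num
      · refine le_of_mul_le_mul_left ?_ (abs_pos.2 ht)
        calc |t| * |lv * (sy - sx)| = |ly - lx| * |sy - sx| := by
              rw [hl, abs_mul, abs_mul, mul_assoc]
          _ ≤ (|ly| + |lx|) * |sy - sx| := by
              gcongr
              exact abs_sub _ _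
          _ ≤ |t| * 4 := by linarith
    have b2 : |ly * (dy * qy)| ≤ 2 * 1 := by
      rw [← mul_assoc, mul_comm ly, abs_mul, abs_mul, abs_of_nonneg hdy]
      gcongr
    have b3 : |lx * (dx * qx)| ≤ 2 * 1 := by
      rw [← mul_assoc, mul_comm lx, abs_mul, abs_mul, abs_of_nonneg hdx]
      gcongr
    have e : lv * sy + ly * (dy * qy) - (lv * sx + lx * (dx * qx)) =
        lv * (sy - sx) + (ly * (dy * qy) - lx * (dx * qx)) := by ring
    rw [e]
    refine (abs_add_le _ _).trans ?_
    have := abs_sub (ly * (dy * qy)) (lx * (dx * qx))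
    linarith

lemma c1OmegaStarOnLines_slowTilt (hR : ∀ k, 2 ^ k ≤ R k) (hu : ‖u‖ = 1)
    (hG : ∀ k, ∀ x ∈ G, |inner ℝ u x| ≤ (1 / 2) ^ k * (R k + ‖x‖)) :
    C1OmegaStarOnLines (fun t => 12 * (R 0 + 1) * √(slowSum R t)) G (slowTilt R u) := by
  intro a _ v hv
  have hder : ∀ t : ℝ, HasDerivAt (fun t : ℝ => slowTilt R u (a + t • v))
      (slowTiltDeriv R u (a + t • v) v) t := fun t => by
    obtain ⟨L, hL, h⟩ := hasFDerivAt_slowTilt (u := u) hR (a + t • v)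
    have hline : HasDerivAt (fun t : ℝ => a + t • v) v t := by
      simpa using ((hasDerivAt_id t).smul_const v).const_add a
    rw [← h]
    exact hL.comp_hasDerivAt t hline
  refine ⟨fun t _ => (hder t).differentiableAt, fun s hs t ht => ?_⟩
  have hsub : ∀ p q : ℝ, ContinuousLinearMap.toSpanSingleton ℝ p -
      ContinuousLinearMap.toSpanSingleton ℝ q = ContinuousLinearMap.toSpanSingleton ℝ (p - q) :=
    fun p q => by ext; simp
  rw [(hder s).hasFDerivAt.fderiv, (hder t).hasFDerivAt.fderiv, hsub,
    ContinuousLinearMap.norm_toSpanSingleton, Real.norm_eq_abs, Real.norm_eq_abs]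
  have e : a + s • v = a + t • v + (s - t) • v := by module
  have ht' : a + t • v ∈ G := ht
  have hs' : a + t • v + (s - t) • v ∈ G := e ▸ hs
  rw [e]
  refine (abs_slowTiltDeriv_sub_le hR hu hG hv ht' hs').trans ?_
  beta_reduce
  rw [mul_assoc]
  exact mul_le_mul_of_nonneg_left (min_le_mul_sqrt_slowSum hR (abs_nonneg _)) (by norm_num)

/-- In the direction `u` the second term of the derivative is a nonnegative multiple of `⟪u, x⟫ ^
2`, so the gradient norm is at least `S = slowSum R (bracket x)`. Comparison with a fixed `x₀` would
give `S ≤ A + B √(S + 2 ‖x₀‖)`, impossible for large `S`. -/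
lemma not_c1Omega_slowTilt (hR : ∀ k, 2 ^ k ≤ R k) (hu : ‖u‖ = 1)
    (hG : ¬ Bornology.IsBounded G) {M : ℝ} (hM : 0 < M) :
    ¬ C1Omega (fun t => M * √(slowSum R t)) G (slowTilt R u) := by
  rintro ⟨K, hK, -, hlip⟩
  obtain ⟨x₀, hx₀⟩ : G.Nonempty :=
    nonempty_iff_ne_empty.2 fun h => hG (h ▸ Bornology.isBounded_empty)
  set A := ‖fderiv ℝ (slowTilt R u) x₀‖
  have hbound : ∀ x ∈ G, slowSum R (bracket x) ≤
      A + K * M * √(slowSum R (bracket x) + 2 * ‖x₀‖) := by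
    intro x hx
    have hbx := one_le_bracket x
    have h1 : slowSum R (bracket x) ≤ fderiv ℝ (slowTilt R u) x u := by
      rw [fderiv_slowTilt hR, slowTiltDeriv, real_inner_self_eq_norm_sq, hu, real_inner_comm u x]
      have h0 := slowSumDeriv_nonneg hR (zero_le_one.trans hbx)
      have : 0 ≤ inner ℝ u x * (slowSumDeriv R (bracket x) * (inner ℝ u x / bracket x)) := by
        rw [show inner ℝ u x * (slowSumDeriv R (bracket x) * (inner ℝ u x / bracket x)) =
          inner ℝ u x ^ 2 * slowSumDeriv R (bracket x) / bracket x by ring]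
        positivity
      linarith
    have h2 : fderiv ℝ (slowTilt R u) x u ≤ ‖fderiv ℝ (slowTilt R u) x‖ := by
      simpa [hu] using (le_abs_self _).trans ((fderiv ℝ (slowTilt R u) x).le_opNorm u)
    have h3 := norm_le_norm_add_norm_sub' (fderiv ℝ (slowTilt R u) x) (fderiv ℝ (slowTilt R u) x₀)
    have h4 := hlip x hx x₀ hx₀
    have h5 : slowSum R ‖x - x₀‖ ≤ slowSum R (bracket x) + 2 * ‖x₀‖ := by
      have hle : ‖x - x₀‖ ≤ bracket x + ‖x₀‖ :=
        (norm_sub_le _ _).trans (by linarith [norm_le_bracket x])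
      have hm : slowSum R ‖x - x₀‖ ≤ slowSum R (bracket x + ‖x₀‖) :=
        monotoneOn_slowSum hR (norm_nonneg _) (by positivity : 0 ≤ bracket x + ‖x₀‖) hle
      have := (le_abs_self _).trans (abs_slowSum_sub_le hR (a := bracket x)
        (b := bracket x + ‖x₀‖) (by linarith) (by positivity))
      rw [add_sub_cancel_left, abs_norm] at this
      linarith
    have h6 : K * (M * √(slowSum R ‖x - x₀‖)) ≤
        K * M * √(slowSum R (bracket x) + 2 * ‖x₀‖) := by
      rw [← mul_assoc]
      gcongr
    linarith
  set B := K * M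
  obtain ⟨r, hr⟩ := (((tendsto_slowSum hR).eventually_ge_atTop
    (2 * ‖x₀‖ + 2 * A + 8 * B ^ 2 + 1)).and (eventually_ge_atTop 0)).exists
  obtain ⟨x, hx, hxr⟩ : ∃ x ∈ G, r < ‖x‖ := by
    by_contra! h
    exact hG (isBounded_iff_forall_norm_le.2 ⟨r, h⟩)
  have hrb : r ≤ bracket x := hxr.le.trans (norm_le_bracket x)
  have hS := hr.1.trans (monotoneOn_slowSum hR hr.2 (hr.2.trans hrb) hrb)
  have hb := hbound x hx
  have hA : 0 ≤ A := norm_nonneg _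
  have hx0 := norm_nonneg x₀
  generalize slowSum R (bracket x) = S at *
  have hsq := Real.sq_sqrt (show 0 ≤ S + 2 * ‖x₀‖ by nlinarith [sq_nonneg B])
  -- The square gives `B q ≤ q ^ 2 / 4 + B ^ 2` for `q = √(S + 2 * ‖x₀‖)`, so `S` would stay below
  -- the chosen threshold.
  nlinarith [sq_nonneg (√(S + 2 * ‖x₀‖) / 2 - B)]

end Bracket

/-! ### From smoothness on lines to the theorem. -/

/-- The first-order Taylor polynomial is the approximant: by the mean value theorem on the segment,
the error is `‖k‖` times a difference of derivatives along one line. -/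
lemma C1OmegaStarOnLines.ut1Smooth {X : Type*} [NormedAddCommGroup X] [NormedSpace ℝ X]
    {ω : ℝ → ℝ} (hω : MonotoneOn ω (Ici 0)) {G : Set X} (hG : Convex ℝ G) {f : X → ℝ}
    (hf : ∀ x ∈ G, DifferentiableAt ℝ f x) (h : C1OmegaStarOnLines ω G f) : UT1Smooth ω G f := by
  intro x hx
  refine ⟨f x, fderiv ℝ f x, fun k hk => ?_⟩
  rcases eq_or_ne k 0 with rfl | hk0
  · simp
  set v := ‖k‖⁻¹ • k with hv
  have hnk : 0 < ‖k‖ := norm_pos_iff.2 hk0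
  have hkv : ‖k‖ • v = k := smul_inv_smul₀ hnk.ne' k
  have hmem : ∀ t ∈ Icc 0 ‖k‖, x + t • v ∈ G := fun t ht => by
    have := hG.add_smul_mem hx hk (t := t * ‖k‖⁻¹)
      ⟨by have := ht.1; positivity, by rw [← div_eq_mul_inv]; exact div_le_one_of_le₀ ht.2 hnk.le⟩
    rwa [mul_smul] at this
  obtain ⟨hd, hlip⟩ := h x hx v (norm_smul_inv_norm hk0)
  have hdiff : ∀ t ∈ Icc 0 ‖k‖, DifferentiableAt ℝ (fun t : ℝ => f (x + t • v)) t :=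
    fun t ht => hd t (hmem t ht)
  obtain ⟨c, hc, hslope⟩ := exists_deriv_eq_slope (fun t : ℝ => f (x + t • v)) hnk
    (fun t ht => (hdiff t ht).continuousAt.continuousWithinAt)
    (fun t ht => (hdiff t (Ioo_subset_Icc_self ht)).differentiableWithinAt)
  have h0mem : (0 : ℝ) ∈ Icc 0 ‖k‖ := ⟨le_rfl, hnk.le⟩
  have h0 : deriv (fun t : ℝ => f (x + t • v)) 0 = fderiv ℝ f x v := by
    have hline : HasDerivAt (fun t : ℝ => x + t • v) v 0 := by
      simpa using ((hasDerivAt_id (0 : ℝ)).smul_const v).const_add x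
    have hfx : HasFDerivAt f (fderiv ℝ f x) (x + (0 : ℝ) • v) := by
      simpa using (hf x hx).hasFDerivAt
    exact (hfx.comp_hasDerivAt 0 hline).deriv
  have hbound := hlip c (hmem c (Ioo_subset_Icc_self hc)) 0 (hmem 0 h0mem)
  have hle : |deriv (fun t : ℝ => f (x + t • v)) c - fderiv ℝ f x v| ≤ ω ‖k‖ := by
    have h1 := ContinuousLinearMap.le_opNorm (fderiv ℝ (fun t : ℝ => f (x + t • v)) c -
      fderiv ℝ (fun t : ℝ => f (x + t • v)) 0) 1
    rw [norm_one, mul_one, sub_apply, fderiv_apply_one_eq_deriv,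
      fderiv_apply_one_eq_deriv, h0, Real.norm_eq_abs] at h1
    rw [sub_zero, Real.norm_of_nonneg hc.1.le] at hbound
    exact h1.trans (hbound.trans (hω hc.1.le hnk.le hc.2.le))
  have hfin : f (x + k) - (f x + fderiv ℝ f x k) =
      ‖k‖ * (deriv (fun t : ℝ => f (x + t • v)) c - fderiv ℝ f x v) := by
    have e : fderiv ℝ f x k = ‖k‖ * fderiv ℝ f x v := by
      rw [← smul_eq_mul, ← map_smul, hkv]
    rw [hslope, e, hkv, zero_smul, add_zero, sub_zero]
    field_simp
    ring
  rw [hfin, abs_mul, abs_norm]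
  exact mul_le_mul_of_nonneg_left hle hnk.le

theorem theorem6p5 (n : ℕ) (hn : 2 ≤ n) (G : Set (EuclideanSpace ℝ (Fin n)))
    (hG_open : IsOpen G) (hG_convex : Convex ℝ G) (hG_unbounded : ¬ Bornology.IsBounded G)
    (hG_cone : ¬ ContainsTranslatedSolidCone G) :
    ∃ ω : ℝ → ℝ, IsModulus ω ∧ ConcaveOn ℝ (Ici 0) ω ∧ Tendsto ω atTop atTop ∧
      ∃ f : EuclideanSpace ℝ (Fin n) → ℝ, ContinuousOn f G ∧
        C1OmegaStarOnLines ω G f ∧ UT1Smooth ω G f ∧ ¬ C1Omega ω G f := by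
  have hne : G.Nonempty :=
    nonempty_iff_ne_empty.2 fun h => hG_unbounded (h ▸ Bornology.isBounded_empty)
  obtain ⟨u, hu1, hu⟩ := exists_unit_orthogonal_recessionCone hne hG_cone
  choose B hB using fun k : ℕ => exists_forall_abs_inner_le hG_open hG_convex hu1 hu
    (show (0 : ℝ) < (1 / 2) ^ k by positivity)
  -- `B k` secures the sublinear bound with `ε = 2⁻ᵏ`; `2 ^ k` secures convergence.
  set R : ℕ → ℝ := fun k => max (B k) (2 ^ k)
  have hR : ∀ k, 2 ^ k ≤ R k := fun k => le_max_right _ _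
  have hM : 0 < 12 * (R 0 + 1) := by
    have := pos_of_two_pow_le hR 0
    positivity
  have hlines := c1OmegaStarOnLines_slowTilt hR hu1 fun k => hB k (R k) (le_max_left _ _)
  have hmod := isModulus_mul_sqrt_slowSum hR hM.le
  exact ⟨_, hmod, concaveOn_mul_sqrt_slowSum hR hM.le, tendsto_mul_sqrt_slowSum hR hM,
    slowTilt R u, (differentiable_slowTilt hR).continuous.continuousOn, hlines,
    hlines.ut1Smooth hmod.mono hG_convex fun x _ => differentiable_slowTilt hR x,
    not_c1Omega_slowTilt hR hu1 hG_unbounded hM⟩
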